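/- Let $G$ be a connected Lie group of dimension at least two whose Lie algebra $\mathfrak g$ is almost abelian, i.e. has an abelian ideal of codimension one, and let $g$ be a left-invariant Riemannian metric on $G$ of constant non-zero sectional curvature. Let $\mathcal A$ be the set of vector fields on $G$ consisting of - the right-invariant vector fields $u\mapsto (\mathcal R_u)_*x$, $x\in\mathfrak g$ (where $\mathcal R_u$ is right translation by $u$), and - the vector fields $\xi_T$ induced by derivations $T$ of $\mathfrak g$ that are skew-symmetric with respect to $g_e$: $(\xi_T)_u=\frac{d}{dt}\big|_{t=0}f_t(u)$, where $(f_t)_{t\in\mathbb R}$ are smooth automorphisms of $G$ with $(f_t)_{*e}=e^{tT}$, for those $T$ for which such automorphisms of $G$ exist (all $T$ if $G$ is simply connected). All of these are Killing vector fields of $(G,g)$. Then $g$, regarded as the contravariant symmetric tensor field $\frac12\sum_i e_i\cdot e_i$ for local orthonormal frames $(e_i)$, is not a polynomial in elements of $\mathcal A$: it does not belong to the real subalgebra generated by $\mathcal A$ in the algebra of sections of $\mathrm{Sym}^\bullet(TG)$ with the symmetric product. -/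

import Mathlib

open Bundle VectorField
open scoped Manifold ContDiff

noncomputable section

namespace AlmostAbelian

/-! ### The metric as an element of the symmetric algebra -/

section Metric

variable (V : Type*) [NormedAddCommGroup V] [InnerProductSpace ℝ V] [FiniteDimensional ℝ V]

/-- The contravariant metric `½ ∑ᵢ eᵢ · eᵢ` of a Euclidean space `V`, where `(eᵢ)` is an orthonormal
basis, in the symmetric algebra of `V`. The basis is irrelevant, see `metricElement_eq`. -/
def metricElement : SymmetricAlgebra ℝ V :=
  (1 / 2 : ℝ) • ∑ i, SymmetricAlgebra.ι ℝ V (stdOrthonormalBasis ℝ V i) *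
    SymmetricAlgebra.ι ℝ V (stdOrthonormalBasis ℝ V i)

theorem metricElement_eq {J : Type*} [Fintype J] (e : OrthonormalBasis J ℝ V) :
    metricElement V = (1 / 2 : ℝ) • ∑ j, SymmetricAlgebra.ι ℝ V (e j) *
      SymmetricAlgebra.ι ℝ V (e j) := by
  classical
  unfold metricElement
  congr 1
  set s := stdOrthonormalBasis ℝ V
  have h1 : ∀ i, SymmetricAlgebra.ι ℝ V (s i) =
      ∑ j, inner ℝ (e j) (s i) • SymmetricAlgebra.ι ℝ V (e j) := by
    intro i
    conv_lhs => rw [← e.sum_repr' (s i)]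
    simp
  have h2 : ∀ j k, ∑ i, inner ℝ (e j) (s i) * inner ℝ (e k) (s i) = if j = k then (1 : ℝ) else 0 := by
    intro j k
    rw [← orthonormal_iff_ite.mp e.orthonormal j k, ← s.sum_inner_mul_inner (e j) (e k)]
    exact Finset.sum_congr rfl fun i _ => by rw [real_inner_comm (s i) (e k)]
  calc _ = ∑ i, ∑ j, ∑ k, (inner ℝ (e j) (s i) * inner ℝ (e k) (s i)) •
        (SymmetricAlgebra.ι ℝ V (e j) * SymmetricAlgebra.ι ℝ V (e k)) := by
        refine Finset.sum_congr rfl fun i _ => ?_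
        rw [h1 i, Finset.sum_mul_sum]
        simp only [smul_mul_smul_comm]
    _ = ∑ j, ∑ k, (∑ i, inner ℝ (e j) (s i) * inner ℝ (e k) (s i)) •
        (SymmetricAlgebra.ι ℝ V (e j) * SymmetricAlgebra.ι ℝ V (e k)) := by
        rw [Finset.sum_comm]
        refine Finset.sum_congr rfl fun j _ => ?_
        rw [Finset.sum_comm]
        simp only [Finset.sum_smul]
    _ = _ := by simp [h2]

end Metric

/-- The exponential of an endomorphism of a finite-dimensional space. -/
def expEnd (V : Type*) [NormedAddCommGroup V] [NormedSpace ℝ V] [FiniteDimensional ℝ V]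
    (A : V →ₗ[ℝ] V) : V →L[ℝ] V :=
  NormedSpace.exp (LinearMap.toContinuousLinearMap A)

/-- A Lie algebra is almost abelian if it has an abelian ideal of codimension one. -/
def IsAlmostAbelian (L : Type*) [LieRing L] [LieAlgebra ℝ L] : Prop :=
  ∃ h : LieIdeal ℝ L, IsLieAbelian h ∧ Module.finrank ℝ (L ⧸ h) = 1

section Manifold

variable {E : Type*} [NormedAddCommGroup E] [NormedSpace ℝ E]
  {H : Type*} [TopologicalSpace H] (I : ModelWithCorners ℝ E H)
  {M : Type*} [TopologicalSpace M] [ChartedSpace H M]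

instance [FiniteDimensional ℝ E] (x : M) : FiniteDimensional ℝ (TangentSpace I x) :=
  inferInstanceAs (FiniteDimensional ℝ E)

variable (M) in
/-- (Not necessarily smooth) contravariant symmetric tensor fields on `M`, of mixed degree: sections
of the bundle of symmetric algebras of the tangent spaces. It is a commutative algebra under the
pointwise symmetric product. -/
abbrev SymTensorField : Type _ := Π x : M, SymmetricAlgebra ℝ (TangentSpace I x)

variable {I} in
/-- A vector field as a symmetric tensor field of degree one. -/
def ofVectorField (X : Π x : M, TangentSpace I x) : SymTensorField I M :=
  fun x => SymmetricAlgebra.ι ℝ (TangentSpace I x) (X x)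

variable (M) in
/-- The Riemannian metric as a symmetric tensor field of degree two. -/
def metricField [FiniteDimensional ℝ E] [RiemannianBundle (fun x : M => TangentSpace I x)] :
    SymTensorField I M :=
  fun x => metricElement (TangentSpace I x)

variable {I}

/-- The curvature `R(X, Y) Z = ∇_X ∇_Y Z - ∇_Y ∇_X Z - ∇_[X, Y] Z` of an affine connection. Note that
`cov Z x (X x)` is `(∇_X Z) x`. -/
def curvature [IsManifold I 1 M] (cov : CovariantDerivative I E (fun x : M => TangentSpace I x))
    (X Y Z : Π x : M, TangentSpace I x) (x : M) : TangentSpace I x :=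
  cov (fun y => cov Z y (Y y)) x (X x) - cov (fun y => cov Z y (X y)) x (Y x)
    - cov Z x (mlieBracket I X Y x)

variable [RiemannianBundle (fun x : M => TangentSpace I x)]

/-- An affine connection is the Levi-Civita connection if it is metric and torsion-free. -/
def IsLeviCivita [FiniteDimensional ℝ E] [IsManifold I 2 M]
    [IsContMDiffRiemannianBundle I 1 E (fun x : M => TangentSpace I x)]
    (cov : CovariantDerivative I E (fun x : M => TangentSpace I x)) : Prop :=
  cov.IsMetricCompatible (V := fun x : M => TangentSpace I x) ∧ cov.torsion = 0

/-- The sectional curvature at `x` of the plane spanned by `X x` and `Y x`. -/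
def sectionalCurvature [IsManifold I 1 M]
    (cov : CovariantDerivative I E (fun x : M => TangentSpace I x))
    (X Y : Π x : M, TangentSpace I x) (x : M) : ℝ :=
  inner ℝ (curvature cov X Y Y x) (X x) /
    (inner ℝ (X x) (X x) * inner ℝ (Y x) (Y x) - inner ℝ (X x) (Y x) ^ 2)

/-- The sectional curvature of every tangent plane equals `κ`. -/
def HasConstantSectionalCurvature [IsManifold I 1 M]
    (cov : CovariantDerivative I E (fun x : M => TangentSpace I x)) (κ : ℝ) : Prop :=
  ∀ X Y : Π x : M, TangentSpace I x,
    ContMDiff I I.tangent ∞ (fun x => (⟨x, X x⟩ : TangentBundle I M)) →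
    ContMDiff I I.tangent ∞ (fun x => (⟨x, Y x⟩ : TangentBundle I M)) →
    ∀ x : M, LinearIndependent ℝ ![X x, Y x] → sectionalCurvature cov X Y x = κ

end Manifold

section LieGroup

variable {E : Type*} [NormedAddCommGroup E] [NormedSpace ℝ E]
  {H : Type*} [TopologicalSpace H] {I : ModelWithCorners ℝ E H}
  {G : Type*} [TopologicalSpace G] [ChartedSpace H G] [Group G]

instance [LieGroup I ∞ G] : LieGroup I (minSmoothness ℝ 3) G :=
  LieGroup.of_le (n := ∞) (by simp only [minSmoothness_of_isRCLikeNormedField]; exact ENat.LEInfty.out)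

/-- The right-invariant vector field with value `v` at the identity. -/
def rightInvariantVectorField (v : GroupLieAlgebra I G) (u : G) : TangentSpace I u :=
  mfderiv I I (· * u) (1 : G) v

variable [RiemannianBundle (fun x : G => TangentSpace I x)]

variable (I G) in
/-- Left translations are isometries. -/
def IsLeftInvariantMetric : Prop :=
  ∀ (a u : G) (v w : TangentSpace I u),
    inner ℝ (mfderiv I I (a * ·) u v) (mfderiv I I (a * ·) u w) = inner ℝ v w

variable [FiniteDimensional ℝ E] [LieGroup I ∞ G]

/-- A derivation of the Lie algebra is skew-symmetric for the inner product induced by the metric. -/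
def IsSkew (T : LieDerivation ℝ (GroupLieAlgebra I G) (GroupLieAlgebra I G)) : Prop :=
  ∀ v w : GroupLieAlgebra I G, inner ℝ (E := TangentSpace I (1 : G)) (T v) w =
    - inner ℝ (E := TangentSpace I (1 : G)) v (T w)

/-- `X` is the vector field induced by the derivation `T`: there are smooth automorphisms `f t` of
`G` with differential `exp (t T)` at the identity, and `X u` is the derivative of `f t u` in `t` at
`0` for every `u`. (If `G` is connected and simply connected, there is exactly one such `X` for every
`T`; if `G` is only connected, `X` exists if and only if the vector field induced by `T` on the
universal cover of `G` descends to `G`.) -/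
def IsInducedBy (T : LieDerivation ℝ (GroupLieAlgebra I G) (GroupLieAlgebra I G))
    (X : Π u : G, TangentSpace I u) : Prop :=
  ∃ f : ℝ → G ≃* G,
    (∀ t, ContMDiff I I ∞ (f t)) ∧
    (∀ (t : ℝ) (v : GroupLieAlgebra I G), tangentMap I I (f t) ⟨1, v⟩ =
      (⟨1, expEnd (TangentSpace I (1 : G)) (t • T.toLinearMap) v⟩ : TangentBundle I G)) ∧
    ∀ u : G, HasMFDerivAt 𝓘(ℝ, ℝ) I (fun t => f t u) 0
      ((1 : ℝ →L[ℝ] ℝ).smulRight (X (f 0 u)))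

variable (I G) in
/-- The right-invariant vector fields and the vector fields induced by skew-symmetric derivations. -/
def algebraicFields : Set (Π u : G, TangentSpace I u) :=
  Set.range rightInvariantVectorField ∪ {X | ∃ T, IsSkew T ∧ IsInducedBy T X}

end LieGroup

end AlmostAbelian

end

/-! Let `e` be a unit normal at the identity to the abelian ideal, and let `B x y` be `∇ₓ y` for
left-invariant fields. The map `x ↦ B x e` is self-adjoint on `eᗮ`, and the curvature of planes
containing `e` gives `|B x e|² - 2⟨B x e, B e x⟩ = -κ |x|²` there. On an eigenvector the cross term
vanishes because `B e` is skew, so the eigenvalue `μ` satisfies `μ² = -κ`. Hence `κ < 0`, and `⟨∇ₓ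
e, x⟩ ≠ 0` for some `x` (`exists_inner_ne_zero`). The same identity makes `ad e` injective, hence
bijective, on the ideal, which forces every skew-symmetric derivation to kill `e`
(`skew_derivation_normal`). The automorphisms it induces then fix the integral curve of `e` through
`1`, so the induced fields vanish there (`eq_zero_of_integralCurve`). Along that curve a polynomial
in the given fields is therefore the right translate of one fixed symmetric tensor. Were the metric
such a polynomial, right-invariant fields would have constant length along the curve. But a
right-invariant `X` commutes with `e`, so `e|X|² = 2⟨∇ₑ X, X⟩ = 2⟨∇_X e, X⟩`, which at `1` is
nonzero for the `x` above. -/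

namespace AlmostAbelian

/-! ### Linear algebra of the Levi-Civita product on an almost abelian Lie algebra -/

section LeviCivitaProduct

variable {V : Type*} [NormedAddCommGroup V] [InnerProductSpace ℝ V]

/-- A function of three arguments that is skew in the last two arguments and symmetric in the first
two vanishes. -/
theorem eq_zero_of_skew_of_symm {α : Type*} {Δ : α → α → α → ℝ}
    (hskew : ∀ x y z, Δ x y z + Δ x z y = 0) (hsymm : ∀ x y z, Δ x y z = Δ y x z) (x y z : α) :
    Δ x y z = 0 := by
  -- Alternating the two symmetries six times returns to `Δ x y z` after three sign changes.
  linarith [hskew x y z, hsymm x y z, hskew y x z, hsymm y z x, hskew z y x, hsymm z x y,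
    hskew x z y, hskew y z x, hskew z x y, hsymm x z y]

/-- A product on a Euclidean space with an alternating bracket which satisfies the algebraic
identities of the Levi-Civita connection on left-invariant vector fields. -/
structure IsLeviCivitaProduct (br B : V →ₗ[ℝ] V →ₗ[ℝ] V) : Prop where
  skew : ∀ x y z, inner ℝ (B x y) z + inner ℝ y (B x z) = 0
  torsion : ∀ x y, B x y - B y x = br x y

/-- An abelian ideal of codimension one with unit normal vector `e`. -/
structure IsAbelianIdealNormal (br : V →ₗ[ℝ] V →ₗ[ℝ] V) (e : V) : Prop where
  norm_eq : inner ℝ e e = (1 : ℝ)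
  ideal : ∀ z x, inner ℝ e x = (0 : ℝ) → inner ℝ e (br z x) = (0 : ℝ)
  abelian : ∀ x y, inner ℝ e x = (0 : ℝ) → inner ℝ e y = (0 : ℝ) → br x y = 0

variable {br B : V →ₗ[ℝ] V →ₗ[ℝ] V} {e : V}

theorem IsLeviCivitaProduct.koszul (hB : IsLeviCivitaProduct br B) (x y z : V) :
    2 * inner ℝ (B x y) z =
      inner ℝ (br x y) z - inner ℝ (br y z) x - inner ℝ (br x z) y := by
  have h1 := hB.skew x y z
  have h2 := hB.skew y x z
  have h3 := hB.skew z x y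
  simp only [← hB.torsion, inner_sub_left]
  have e1 := real_inner_comm y (B x z)
  have e2 := real_inner_comm x (B y z)
  have e3 := real_inner_comm x (B z y)
  linarith

/-- Modulo the ideal, both arguments are multiples of `e`, and `br e e = 0`. -/
theorem IsAbelianIdealNormal.bracket_mem (he : IsAbelianIdealNormal br e)
    (halt : ∀ x, br x x = 0) (z w : V) : inner ℝ e (br z w) = (0 : ℝ) := by
  have key : ∀ w, inner ℝ e (w - (inner ℝ e w : ℝ) • e) = (0 : ℝ) := fun w => by
    rw [inner_sub_right, inner_smul_right, he.norm_eq]; ring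
  have hswap : ∀ a b, br a b = - br b a := fun a b => by
    have := halt (a + b)
    simp only [map_add, LinearMap.add_apply, halt, zero_add, add_zero] at this
    exact eq_neg_of_add_eq_zero_right this
  have h1 : br z w = br z (w - (inner ℝ e w : ℝ) • e) - (inner ℝ e w : ℝ) •
      br e (z - (inner ℝ e z : ℝ) • e) := by
    rw [hswap e]
    simp only [map_sub, map_smul, LinearMap.sub_apply, LinearMap.smul_apply, halt]
    simp
  rw [h1, inner_sub_right, inner_smul_right, he.ideal _ _ (key w), he.ideal _ _ (key z)]
  simp

theorem IsLeviCivitaProduct.self_normal (hB : IsLeviCivitaProduct br B)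
    (he : IsAbelianIdealNormal br e) (halt : ∀ x, br x x = 0) : B e e = 0 := by
  refine ext_inner_right ℝ fun z => ?_
  have h := hB.koszul e e z
  rw [halt, real_inner_comm e (br e z), he.bracket_mem halt] at h
  simp only [inner_zero_left] at h ⊢
  linarith

variable {κ : ℝ}

/-- The identity `|Sx|² + 2⟨Sx, Kx⟩ = -κ |x|²` for `S x = -∇ₓ e` and `K x = ∇ₑ x`. -/
theorem IsLeviCivitaProduct.curvature_normal (hB : IsLeviCivitaProduct br B)
    (he : IsAbelianIdealNormal br e) (halt : ∀ x, br x x = 0)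
    (hκ : ∀ x, x ≠ 0 → inner ℝ e x = (0 : ℝ) →
      inner ℝ (B x (B e e) - B e (B x e) - B (br x e) e) x = κ * inner ℝ x x)
    {x : V} (hx : inner ℝ e x = (0 : ℝ)) :
    inner ℝ (B x e) (B x e) - 2 * inner ℝ (B x e) (B e x) = - κ * inner ℝ x x := by
  -- On the ideal the antisymmetric part of `y ↦ B y e` is, by Koszul, a multiple of `⟨e, br y z⟩`,
  -- which vanishes.
  have hsymm : ∀ y z, inner ℝ e y = (0 : ℝ) → inner ℝ e z = (0 : ℝ) →
      inner ℝ (B y e) z = (inner ℝ (B z e) y : ℝ) := fun y z hy hz => by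
    have h1 := hB.koszul y e z
    have h2 := hB.koszul z e y
    rw [he.abelian y z hy hz] at h1
    rw [he.abelian z y hz hy] at h2
    have h3 : br y e = - br e y := by rw [← hB.torsion, ← hB.torsion, neg_sub]
    have h4 : br z e = - br e z := by rw [← hB.torsion, ← hB.torsion, neg_sub]
    rw [h3, inner_neg_left, inner_zero_left] at h1
    rw [h4, inner_neg_left, inner_zero_left] at h2
    linarith
  rcases eq_or_ne x 0 with rfl | hx0
  · simp
  have h := hκ x hx0 hx
  have hbe : inner ℝ e (br x e) = (0 : ℝ) := he.bracket_mem halt _ _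
  rw [hB.self_normal he halt, map_zero, inner_sub_left, inner_sub_left, inner_zero_left,
    hsymm _ _ hbe hx, ← hB.torsion, inner_sub_right] at h
  have h1 := hB.skew e (B x e) x
  linarith

variable [FiniteDimensional ℝ V]

open Module in
-- The spectral theorem for `x ↦ B x e`, which maps into `eᗮ` because `e` has constant length and is
-- self-adjoint there; `eᗮ` is nonzero since the dimension is at least two.
theorem IsLeviCivitaProduct.exists_eigenvector (hB : IsLeviCivitaProduct br B)
    (he : IsAbelianIdealNormal br e) (hdim : 2 ≤ finrank ℝ V) :
    ∃ x : V, x ≠ 0 ∧ inner ℝ e x = (0 : ℝ) ∧ ∃ μ : ℝ, B x e = μ • x := by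
  let W : Submodule ℝ V := (ℝ ∙ e)ᗮ
  have hW : ∀ x, x ∈ W ↔ inner ℝ e x = (0 : ℝ) := fun x =>
    Submodule.mem_orthogonal_singleton_iff_inner_right
  have he0 : e ≠ 0 := fun h => by simpa [h] using he.norm_eq
  let S : W →ₗ[ℝ] W := ((B.flip e).comp W.subtype).codRestrict W fun x => by
    rw [hW]
    have := hB.skew x e e
    rw [real_inner_comm] at this
    simp only [LinearMap.comp_apply, Submodule.subtype_apply, LinearMap.flip_apply]
    linarith [real_inner_comm e (B x e)]
  have hS : S.IsSymmetric := fun y z => by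
    have hy := (hW y).1 y.2
    have hz := (hW z).1 z.2
    have h1 := hB.koszul y e z
    have h2 := hB.koszul z e y
    rw [he.abelian y z hy hz] at h1
    rw [he.abelian z y hz hy] at h2
    have h3 : br y e = - br e y := by rw [← hB.torsion, ← hB.torsion, neg_sub]
    have h4 : br z e = - br e z := by rw [← hB.torsion, ← hB.torsion, neg_sub]
    rw [h3, inner_neg_left, inner_zero_left] at h1
    rw [h4, inner_neg_left, inner_zero_left] at h2
    change inner ℝ (B y e) (z : V) = inner ℝ (y : V) (B z e)
    linarith [real_inner_comm (y : V) (B z e)]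
  have hfin : finrank ℝ W + 1 = finrank ℝ V := by
    have := Submodule.finrank_add_finrank_orthogonal (ℝ ∙ e)
    rw [finrank_span_singleton he0] at this
    linarith
  have : Nontrivial W := Module.nontrivial_of_finrank_pos (R := ℝ) (by omega)
  obtain ⟨v, hv⟩ := hS.hasEigenvalue_iSup_of_finiteDimensional.exists_hasEigenvector
  exact ⟨v, by simpa using hv.2, (hW v).1 v.2, _, congrArg Subtype.val hv.apply_eq_smul⟩

section Curved

variable (hB : IsLeviCivitaProduct br B) (he : IsAbelianIdealNormal br e) (halt : ∀ x, br x x = 0)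
  (hdim : 2 ≤ Module.finrank ℝ V)
  (hκ : ∀ x, x ≠ 0 → inner ℝ e x = (0 : ℝ) →
    inner ℝ (B x (B e e) - B e (B x e) - B (br x e) e) x = κ * inner ℝ x x) (hκ0 : κ ≠ 0)

include hB he halt hdim hκ
theorem IsLeviCivitaProduct.exists_sq_eq :
    ∃ x : V, x ≠ 0 ∧ ∃ μ : ℝ, B x e = μ • x ∧ μ ^ 2 = - κ := by
  obtain ⟨x, hx0, hx, μ, hμ⟩ := hB.exists_eigenvector he hdim
  refine ⟨x, hx0, μ, hμ, ?_⟩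
  have h := hB.curvature_normal he halt hκ hx
  have h1 := hB.skew e x x
  rw [real_inner_comm] at h1
  rw [hμ, inner_smul_left, inner_smul_left, inner_smul_right] at h
  simp only [conj_trivial] at h
  have h2 : (inner ℝ x x : ℝ) ≠ 0 := inner_self_ne_zero.2 hx0
  refine mul_right_cancel₀ h2 ?_
  have h3 : (inner ℝ x (B e x) : ℝ) = 0 := by linarith
  rw [h3] at h
  linarith

include hκ0

theorem IsLeviCivitaProduct.exists_inner_ne_zero : ∃ x : V, inner ℝ (B x e) x ≠ (0 : ℝ) := by
  obtain ⟨x, hx0, μ, hμ, h⟩ := hB.exists_sq_eq he halt hdim hκ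
  refine ⟨x, ?_⟩
  rw [hμ, inner_smul_left]
  refine mul_ne_zero (fun h0 => hκ0 ?_) (inner_self_ne_zero.2 hx0)
  simp only [conj_trivial] at h0
  rw [h0] at h
  linarith

/-- Every `y` in the ideal is some `br e x`, so `⟨T e, y⟩ = -⟨e, T (br e x)⟩`; the derivation rule
turns this into brackets, all orthogonal to `e`. -/
theorem IsLeviCivitaProduct.skew_derivation_normal {T : V →ₗ[ℝ] V}
    (hT : ∀ x y, inner ℝ (T x) y = - (inner ℝ x (T y) : ℝ))
    (hder : ∀ x y, T (br x y) = br (T x) y + br x (T y)) : T e = 0 := by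
  obtain ⟨-, -, μ, -, hμ⟩ := hB.exists_sq_eq he halt hdim hκ
  let W : Submodule ℝ V := (ℝ ∙ e)ᗮ
  have hW : ∀ x, x ∈ W ↔ inner ℝ e x = (0 : ℝ) := fun x =>
    Submodule.mem_orthogonal_singleton_iff_inner_right
  let D : W →ₗ[ℝ] W := ((br e).comp W.subtype).codRestrict W fun x => by
    rw [hW]
    exact he.bracket_mem halt _ _
  -- If `br e x = 0` then `B x e = B e x`, and the curvature identity reads `-|B x e|² = -κ |x|²`
  -- with `-κ > 0`.
  have hD : Function.Injective D := by
    rw [injective_iff_map_eq_zero]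
    intro x hx
    have hx' : br e x = 0 := congrArg Subtype.val hx
    have h := hB.curvature_normal he halt hκ ((hW x).1 x.2)
    rw [← hB.torsion, sub_eq_zero] at hx'
    rw [hx'] at h
    have h1 : (0 : ℝ) ≤ inner ℝ (B x e) (B x e) := real_inner_self_nonneg
    have h2 : (0 : ℝ) ≤ inner ℝ (x : V) x := real_inner_self_nonneg
    have h3 : 0 < - κ := lt_of_le_of_ne (hμ ▸ sq_nonneg μ) (by simpa using hκ0)
    have h4 : (inner ℝ (x : V) x : ℝ) = 0 := by nlinarith
    exact Subtype.ext (inner_self_eq_zero.1 h4)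
  have hsurj := LinearMap.injective_iff_surjective.1 hD
  have h0 : ∀ y, inner ℝ e y = (0 : ℝ) → inner ℝ (T e) y = (0 : ℝ) := fun y hy => by
    obtain ⟨x, hx⟩ := hsurj ⟨y, (hW y).2 hy⟩
    have hx' : br e x = y := congrArg Subtype.val hx
    rw [hT, ← hx', hder, inner_add_right, he.bracket_mem halt, he.bracket_mem halt]
    simp
  refine (inner_self_eq_zero (𝕜 := ℝ)).1 (h0 (T e) ?_)
  have := hT e e
  rw [real_inner_comm] at this
  linarith

end Curved

end LeviCivitaProduct

/-! ### Left- and right-invariant vector fields -/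

section

variable {E : Type*} [NormedAddCommGroup E] [NormedSpace ℝ E]
  {H : Type*} [TopologicalSpace H] {I : ModelWithCorners ℝ E H}
  {M : Type*} [TopologicalSpace M] [ChartedSpace H M]

theorem mfderiv_comp_eq_id {f g : M → M} (hf : ContMDiff I I ∞ f) (hg : ContMDiff I I ∞ g)
    (hgf : g ∘ f = id) (x : M) (v : TangentSpace I x) :
    (mfderiv I I g (f x) (mfderiv I I f x v) : E) = v := by
  have h := mfderiv_comp (I' := I) x (hg.mdifferentiableAt (by simp))
    (hf.mdifferentiableAt (by simp))
  rw [hgf] at h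
  have h2 := (mfderiv_id (I := I) (M := M) (x := x)).symm.trans h
  exact (congrArg (fun A : E →L[ℝ] E => A v) h2).symm

end

section InvariantFields

variable {E : Type*} [NormedAddCommGroup E] [NormedSpace ℝ E]
  {H : Type*} [TopologicalSpace H] {I : ModelWithCorners ℝ E H}
  {G : Type*} [TopologicalSpace G] [ChartedSpace H G] [Group G]

theorem mulInvariantVectorField_one (v : GroupLieAlgebra I G) :
    mulInvariantVectorField v (1 : G) = v := by
  have h : ((1 : G) * ·) = (id : G → G) := by ext; simp
  unfold mulInvariantVectorField
  rw [h]
  exact congrArg (fun A : E →L[ℝ] E => A v) (mfderiv_id (I := I) (M := G) (x := (1 : G)))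

theorem rightInvariantVectorField_one (v : GroupLieAlgebra I G) :
    rightInvariantVectorField v (1 : G) = v := by
  have h : (· * (1 : G)) = (id : G → G) := by ext; simp
  unfold rightInvariantVectorField
  rw [h]
  exact congrArg (fun A : E →L[ℝ] E => A v) (mfderiv_id (I := I) (M := G) (x := (1 : G)))

variable [LieGroup I ∞ G]

/-- Invariant fields arise by feeding this map the zero section in one slot and a constant vector at
`1` in the other, whence their smoothness. -/
theorem contMDiff_tangentMap_mul :
    ContMDiff (I.tangent.prod I.tangent) I.tangent ∞
      (fun p : TangentBundle I G × TangentBundle I G =>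
        tangentMap (I.prod I) I (fun q : G × G => q.1 * q.2)
          ((equivTangentBundleProd I G I G).symm p)) := by
  have h : ContMDiff (I.prod I).tangent I.tangent ∞
      (tangentMap (I.prod I) I (fun q : G × G => q.1 * q.2)) :=
    (contMDiff_mul I ∞).contMDiff_tangentMap (m := ∞) (by simp)
  exact h.comp contMDiff_equivTangentBundleProd_symm

theorem add_left_eq_self_of_map_zero (A : E →L[ℝ] E) (w : E) : A 0 + w = w := by simp

theorem add_right_eq_self_of_map_zero (A : E →L[ℝ] E) (w : E) : w + A 0 = w := by simp

theorem contMDiff_mulInvariantVectorField_infty (v : GroupLieAlgebra I G) :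
    ContMDiff I I.tangent ∞
      (fun g : G => (⟨g, mulInvariantVectorField v g⟩ : TangentBundle I G)) := by
  have h0 : ContMDiff I I.tangent ∞ (fun g : G => (⟨g, 0⟩ : TangentBundle I G)) :=
    contMDiff_zeroSection ℝ (TangentSpace I : G → Type _)
  have hv : ContMDiff I I.tangent ∞ (fun _ : G => (⟨1, v⟩ : TangentBundle I G)) :=
    contMDiff_const
  have h := (contMDiff_tangentMap_mul (I := I) (G := G)).comp (h0.prodMk hv)
  convert! h with g
  · simp
  · simp only [Function.comp_apply, tangentMap]
    rw [mfderiv_prod_eq_add_apply ((contMDiff_mul I ∞).mdifferentiableAt (by simp))]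
    exact (add_left_eq_self_of_map_zero (E := E) (mfderiv I I (· * (1 : G)) g) _).symm

theorem contMDiff_rightInvariantVectorField (v : GroupLieAlgebra I G) :
    ContMDiff I I.tangent ∞
      (fun g : G => (⟨g, rightInvariantVectorField v g⟩ : TangentBundle I G)) := by
  have h0 : ContMDiff I I.tangent ∞ (fun g : G => (⟨g, 0⟩ : TangentBundle I G)) :=
    contMDiff_zeroSection ℝ (TangentSpace I : G → Type _)
  have hv : ContMDiff I I.tangent ∞ (fun _ : G => (⟨1, v⟩ : TangentBundle I G)) :=
    contMDiff_const
  have h := (contMDiff_tangentMap_mul (I := I) (G := G)).comp (hv.prodMk h0)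
  convert! h with g
  · simp
  · simp only [Function.comp_apply, tangentMap]
    rw [mfderiv_prod_eq_add_apply ((contMDiff_mul I ∞).mdifferentiableAt (by simp))]
    exact (add_right_eq_self_of_map_zero (E := E) (mfderiv I I ((1 : G) * ·) g) _).symm

variable (I) in
/-- Right translation by `u` as a linear map from the Lie algebra to the tangent space at `u`. -/
noncomputable def rightTranslation (u : G) : GroupLieAlgebra I G →ₗ[ℝ] TangentSpace I u where
  toFun v := rightInvariantVectorField v u
  map_add' v w := (mfderiv I I (· * u) (1 : G)).map_add v w
  map_smul' c v := (mfderiv I I (· * u) (1 : G)).map_smul c v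

variable (I) in
/-- Left translation by `u` as a linear map from the Lie algebra to the tangent space at `u`. -/
noncomputable def leftTranslation (u : G) : GroupLieAlgebra I G →ₗ[ℝ] TangentSpace I u where
  toFun v := mulInvariantVectorField v u
  map_add' v w := (mfderiv I I (u * ·) (1 : G)).map_add v w
  map_smul' c v := (mfderiv I I (u * ·) (1 : G)).map_smul c v

theorem rightTranslation_injective (u : G) : Function.Injective (rightTranslation I u) := by
  refine Function.HasLeftInverse.injective
    ⟨fun w => mfderiv I I (· * u⁻¹) ((1 : G) * u) w, fun v => ?_⟩
  exact mfderiv_comp_eq_id (contMDiff_mul_right (a := u)) (contMDiff_mul_right (a := u⁻¹))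
    (by ext; simp) 1 v

theorem leftTranslation_injective (u : G) : Function.Injective (leftTranslation I u) := by
  refine Function.HasLeftInverse.injective
    ⟨fun w => mfderiv I I (u⁻¹ * ·) (u * (1 : G)) w, fun v => ?_⟩
  exact mfderiv_comp_eq_id (contMDiff_mul_left (a := u)) (contMDiff_mul_left (a := u⁻¹))
    (by ext; simp) 1 v

theorem leftTranslation_surjective [FiniteDimensional ℝ E] (u : G) :
    Function.Surjective (leftTranslation I u) :=
  (LinearMap.injective_iff_surjective (f := (leftTranslation I u : E →ₗ[ℝ] E))).1
    (leftTranslation_injective u)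

end InvariantFields

/-! ### The Levi-Civita connection on left-invariant fields -/

section LeviCivita

variable {E : Type*} [NormedAddCommGroup E] [NormedSpace ℝ E]
    {G : Type*} [TopologicalSpace G] [ChartedSpace E G] [Group G]

theorem inner_mulInvariantVectorField [RiemannianBundle (fun x : G => TangentSpace 𝓘(ℝ, E) x)]
    (hg : IsLeftInvariantMetric 𝓘(ℝ, E) G)
    (v w : GroupLieAlgebra 𝓘(ℝ, E) G) (u : G) :
    inner ℝ (mulInvariantVectorField v u) (mulInvariantVectorField w u) =
      (inner ℝ (E := TangentSpace 𝓘(ℝ, E) (1 : G)) v w : ℝ) := by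
  have h := hg u 1 v w
  -- Left-invariance of the metric gives an inner product at `u * 1`, which has to be transported to
  -- `u`.
  have key : ∀ z, z = u → ∀ a b : E,
      inner ℝ (E := TangentSpace 𝓘(ℝ, E) z) a b = (inner ℝ (E := TangentSpace 𝓘(ℝ, E) u) a b : ℝ) := by
    rintro z rfl a b; rfl
  exact (key _ (mul_one u) _ _).symm.trans h

variable [LieGroup 𝓘(ℝ, E) ∞ G]

theorem mdifferentiableAt_mulInvariantVectorField_infty (v : GroupLieAlgebra 𝓘(ℝ, E) G) (u : G) :
    MDifferentiableAt 𝓘(ℝ, E) 𝓘(ℝ, E).tangent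
      (fun g : G => (⟨g, mulInvariantVectorField v g⟩ : TangentBundle 𝓘(ℝ, E) G)) u :=
  (contMDiff_mulInvariantVectorField_infty v).mdifferentiable (by simp) u

variable [FiniteDimensional ℝ E] [RiemannianBundle (fun x : G => TangentSpace 𝓘(ℝ, E) x)]
    [IsContMDiffRiemannianBundle 𝓘(ℝ, E) ∞ E (fun x : G => TangentSpace 𝓘(ℝ, E) x)]

variable (cov : CovariantDerivative 𝓘(ℝ, E) E (fun x : G => TangentSpace 𝓘(ℝ, E) x))

/-- The covariant derivative of left-invariant vector fields, as a product on the Lie algebra. -/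
noncomputable def leviCivitaProduct :
    TangentSpace 𝓘(ℝ, E) (1 : G) →ₗ[ℝ] TangentSpace 𝓘(ℝ, E) (1 : G) →ₗ[ℝ]
      TangentSpace 𝓘(ℝ, E) (1 : G) :=
  LinearMap.mk₂ ℝ (fun x y => cov (mulInvariantVectorField y) 1 x)
    (fun x x' y => map_add _ x x') (fun c x y => map_smul _ c x)
    (fun x y y' => by
      have h := cov.isCovariantDerivativeOn.add (x := (1 : G))
        (mdifferentiableAt_mulInvariantVectorField_infty y 1)
        (mdifferentiableAt_mulInvariantVectorField_infty y' 1)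
      have h2 : (mulInvariantVectorField (y + y') : Π g : G, TangentSpace 𝓘(ℝ, E) g) =
        mulInvariantVectorField y + mulInvariantVectorField y' := mulInvariantVectorField_add y y'
      rw [h2, h]; rfl)
    (fun c x y => by
      have h := cov.isCovariantDerivativeOn.smul_const (x := (1 : G)) c
        (mdifferentiableAt_mulInvariantVectorField_infty y 1)
      have h2 : (mulInvariantVectorField (c • y) : Π g : G, TangentSpace 𝓘(ℝ, E) g) =
        c • mulInvariantVectorField y := mulInvariantVectorField_smul c y
      rw [h2, h]; rfl)

variable (E G) in
/-- The Lie bracket as a bilinear map. -/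
noncomputable def lieBracketProduct :
    TangentSpace 𝓘(ℝ, E) (1 : G) →ₗ[ℝ] TangentSpace 𝓘(ℝ, E) (1 : G) →ₗ[ℝ]
      TangentSpace 𝓘(ℝ, E) (1 : G) :=
  LinearMap.mk₂ ℝ (fun x y : GroupLieAlgebra 𝓘(ℝ, E) G => ⁅x, y⁆)
    (fun x x' y => add_lie x x' y) (fun c x y => smul_lie c x y)
    (fun x y y' => lie_add x y y') (fun c x y => lie_smul c x y)

variable {cov}

theorem inner_cov_mulInvariant (hg : IsLeftInvariantMetric 𝓘(ℝ, E) G) (hcov : IsLeviCivita cov)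
    (x y z : GroupLieAlgebra 𝓘(ℝ, E) G) (u : G) :
    inner ℝ (cov (mulInvariantVectorField y) u (mulInvariantVectorField x u))
        (mulInvariantVectorField z u) +
      inner ℝ (mulInvariantVectorField y u)
        (cov (mulInvariantVectorField z) u (mulInvariantVectorField x u)) = (0 : ℝ) := by
  have h := hcov.1.mvfderiv_inner_eq (mulInvariantVectorField x)
    (mdifferentiableAt_mulInvariantVectorField_infty y u)
    (mdifferentiableAt_mulInvariantVectorField_infty z u)
  refine h.symm.trans ?_
  have h2 : (fun g : G => inner ℝ (mulInvariantVectorField y g : TangentSpace 𝓘(ℝ, E) g)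
      (mulInvariantVectorField z g)) =
      fun _ => (inner ℝ (E := TangentSpace 𝓘(ℝ, E) (1 : G)) y z : ℝ) :=
    funext fun g => inner_mulInvariantVectorField hg y z g
  rw [h2]
  simp [mvfderiv, mfderiv_const]

theorem cov_mulInvariant_sub (hcov : IsLeviCivita cov)
    (x y : GroupLieAlgebra 𝓘(ℝ, E) G) (u : G) :
    cov (mulInvariantVectorField y) u (mulInvariantVectorField x u) -
      cov (mulInvariantVectorField x) u (mulInvariantVectorField y u) =
      mulInvariantVectorField ⁅x, y⁆ u := by
  have h := (cov.torsion_eq_zero_iff).1 hcov.2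
    (mdifferentiableAt_mulInvariantVectorField_infty x u)
    (mdifferentiableAt_mulInvariantVectorField_infty y u)
  rw [h, GroupLieAlgebra.bracket_def, mulInvariantVector_mlieBracket]

theorem isLeviCivitaProduct (hg : IsLeftInvariantMetric 𝓘(ℝ, E) G) (hcov : IsLeviCivita cov) :
    IsLeviCivitaProduct (lieBracketProduct E G) (leviCivitaProduct cov) where
  skew x y z := by
    have h := inner_cov_mulInvariant hg hcov x y z 1
    rwa [mulInvariantVectorField_one, mulInvariantVectorField_one, mulInvariantVectorField_one] at h
  torsion x y := by
    have h := cov_mulInvariant_sub hcov x y 1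
    rwa [mulInvariantVectorField_one, mulInvariantVectorField_one, mulInvariantVectorField_one] at h

/-- Uniqueness in Koszul's argument: the connections at `u` and at `1` are both metric with the same
torsion term, so their difference is skew in the last two arguments and symmetric in the first two.
-/
theorem cov_mulInvariant (hg : IsLeftInvariantMetric 𝓘(ℝ, E) G) (hcov : IsLeviCivita cov)
    (x y : GroupLieAlgebra 𝓘(ℝ, E) G) (u : G) :
    cov (mulInvariantVectorField y) u (mulInvariantVectorField x u) =
      mulInvariantVectorField (leviCivitaProduct cov x y) u := by
  refine ext_inner_right ℝ fun w => ?_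
  obtain ⟨z, rfl⟩ := leftTranslation_surjective (I := 𝓘(ℝ, E)) u w
  change inner ℝ _ (mulInvariantVectorField z u) = inner ℝ _ (mulInvariantVectorField z u)
  rw [inner_mulInvariantVectorField hg, ← sub_eq_zero]
  have hB := isLeviCivitaProduct hg hcov
  refine eq_zero_of_skew_of_symm (Δ := fun x y z : TangentSpace 𝓘(ℝ, E) (1 : G) =>
    inner ℝ (cov (mulInvariantVectorField y) u (mulInvariantVectorField x u))
        (mulInvariantVectorField z u) -
      inner ℝ (E := TangentSpace 𝓘(ℝ, E) (1 : G)) (leviCivitaProduct cov x y) z)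
      (fun x y z => ?_) (fun x y z => ?_) x y z
  · have h1 := inner_cov_mulInvariant hg hcov x y z u
    have h2 := hB.skew x y z
    have h3 := real_inner_comm y (leviCivitaProduct cov x z)
    have h4 := real_inner_comm (mulInvariantVectorField y u)
      (cov (mulInvariantVectorField z) u (mulInvariantVectorField x u))
    linarith
  · have h1 := congrArg (fun v => (inner ℝ v (mulInvariantVectorField z u) : ℝ))
      (cov_mulInvariant_sub hcov x y u)
    have h2 : (inner ℝ (leviCivitaProduct cov x y - leviCivitaProduct cov y x) z : ℝ) =
        inner ℝ (lieBracketProduct E G x y) z := by rw [hB.torsion]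
    rw [inner_sub_left] at h2
    simp only [inner_sub_left, inner_mulInvariantVectorField hg] at h1
    have h3 : (inner ℝ (E := TangentSpace 𝓘(ℝ, E) (1 : G)) (lieBracketProduct E G x y) z : ℝ) =
      inner ℝ (E := TangentSpace 𝓘(ℝ, E) (1 : G)) ⁅x, y⁆ z := rfl
    linarith

theorem inner_leviCivitaProduct_curvature (hg : IsLeftInvariantMetric 𝓘(ℝ, E) G)
    (hcov : IsLeviCivita cov) {κ : ℝ} (hcurv : HasConstantSectionalCurvature cov κ)
    {e : TangentSpace 𝓘(ℝ, E) (1 : G)} (he : inner ℝ e e = (1 : ℝ))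
    (x : TangentSpace 𝓘(ℝ, E) (1 : G)) (hx0 : x ≠ 0) (hx : inner ℝ e x = (0 : ℝ)) :
    inner ℝ (leviCivitaProduct cov x (leviCivitaProduct cov e e) -
      leviCivitaProduct cov e (leviCivitaProduct cov x e) -
      leviCivitaProduct cov (lieBracketProduct E G x e) e) x = κ * inner ℝ x x := by
  have hx' : inner ℝ x e = (0 : ℝ) := by rw [real_inner_comm, hx]
  have hli : LinearIndependent ℝ ![x, e] := by
    rw [LinearIndependent.pair_iff]
    intro s t hst
    have h1 := congrArg (fun v => (inner ℝ v x : ℝ)) hst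
    have h2 := congrArg (fun v => (inner ℝ v e : ℝ)) hst
    simp only [inner_add_left, inner_smul_left, conj_trivial, hx, hx', he, inner_zero_left] at h1 h2
    have h3 : (inner ℝ x x : ℝ) ≠ 0 := inner_self_ne_zero.2 hx0
    refine ⟨?_, by simpa using h2⟩
    simpa [hx0] using h1
  have h := hcurv (mulInvariantVectorField x) (mulInvariantVectorField e)
    (contMDiff_mulInvariantVectorField_infty x) (contMDiff_mulInvariantVectorField_infty e) 1
    (by rwa [mulInvariantVectorField_one, mulInvariantVectorField_one])
  have h3 : (inner ℝ x x : ℝ) ≠ 0 := inner_self_ne_zero.2 hx0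
  -- Covariant derivatives of left-invariant fields are again left-invariant, so the second
  -- derivatives in the curvature become iterated products.
  have hfun : ∀ x y : GroupLieAlgebra 𝓘(ℝ, E) G,
    (fun u => cov (mulInvariantVectorField y) u (mulInvariantVectorField x u)) =
      mulInvariantVectorField (leviCivitaProduct cov x y) := fun x y =>
    funext fun u => cov_mulInvariant hg hcov x y u
  rw [sectionalCurvature, curvature, hfun, hfun, mulInvariantVectorField_one,
    mulInvariantVectorField_one, he, hx', div_eq_iff (by simpa using h3)] at h
  refine Eq.trans ?_ (h.trans ?_)
  · rfl
  · ring

end LeviCivita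

/-! ### Commutation of left- and right-invariant fields -/

section ModelSpace

open Filter Topology

variable {E : Type*} [NormedAddCommGroup E] [NormedSpace ℝ E]

/-- In a local multiplication with unit `p`, infinitesimal left and right translations commute at
the unit. -/
theorem lieBracket_eq_zero_of_local_mul {μ : E × E → E} {p : E} (hμ : ContDiffAt ℝ 2 μ (p, p))
    (hleft : ∀ᶠ b in 𝓝 p, μ (p, b) = b) (hright : ∀ᶠ a in 𝓝 p, μ (a, p) = a)
    (x y : E) {V W : E → E} (hV : ∀ᶠ a in 𝓝 p, V a = fderiv ℝ μ (a, p) (0, x))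
    (hW : ∀ᶠ b in 𝓝 p, W b = fderiv ℝ μ (p, b) (y, 0)) :
    lieBracket ℝ V W p = 0 := by
  have hd : DifferentiableAt ℝ μ (p, p) := hμ.differentiableAt (by simp)
  have hd2 : DifferentiableAt ℝ (fderiv ℝ μ) (p, p) :=
    (hμ.fderiv_right (m := 1) (by norm_num)).differentiableAt (by simp)
  have hl : HasFDerivAt (fun a : E => (a, p)) (ContinuousLinearMap.inl ℝ E E) p :=
    hasFDerivAt_prodMk_left p p
  have hr : HasFDerivAt (fun b : E => (p, b)) (ContinuousLinearMap.inr ℝ E E) p :=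
    hasFDerivAt_prodMk_right p p
  have hVp : V p = x := by
    have h1 : HasFDerivAt (fun b => μ (p, b)) ((fderiv ℝ μ (p, p)).comp
        (ContinuousLinearMap.inr ℝ E E)) p := hd.hasFDerivAt.comp p hr
    have h2 := h1.unique ((hasFDerivAt_id p).congr_of_eventuallyEq hleft)
    rw [hV.self_of_nhds]
    simpa using congrArg (fun A => A x) h2
  have hWp : W p = y := by
    have h1 : HasFDerivAt (fun a => μ (a, p)) ((fderiv ℝ μ (p, p)).comp
        (ContinuousLinearMap.inl ℝ E E)) p :=
      HasFDerivAt.comp (g := μ) (f := fun a => (a, p)) p hd.hasFDerivAt hl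
    have h2 := h1.unique ((hasFDerivAt_id p).congr_of_eventuallyEq hright)
    rw [hW.self_of_nhds]
    simpa using congrArg (fun A => A y) h2
  have hV' : HasFDerivAt V (((fderiv ℝ (fderiv ℝ μ) (p, p)).comp
      (ContinuousLinearMap.inl ℝ E E)).flip (0, x)) p := by
    have h1 : HasFDerivAt (fun a => fderiv ℝ μ (a, p)) ((fderiv ℝ (fderiv ℝ μ) (p, p)).comp
        (ContinuousLinearMap.inl ℝ E E)) p :=
      HasFDerivAt.comp (g := fderiv ℝ μ) (f := fun a => (a, p)) p hd2.hasFDerivAt hl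
    refine HasFDerivAt.congr_of_eventuallyEq ?_ hV
    convert h1.clm_apply (hasFDerivAt_const (0, x) p) using 1
    ext; simp
  have hW' : HasFDerivAt W (((fderiv ℝ (fderiv ℝ μ) (p, p)).comp
      (ContinuousLinearMap.inr ℝ E E)).flip (y, 0)) p := by
    have h1 : HasFDerivAt (fun b => fderiv ℝ μ (p, b)) ((fderiv ℝ (fderiv ℝ μ) (p, p)).comp
        (ContinuousLinearMap.inr ℝ E E)) p := hd2.hasFDerivAt.comp p hr
    refine HasFDerivAt.congr_of_eventuallyEq ?_ hW
    convert h1.clm_apply (hasFDerivAt_const (y, 0) p) using 1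
    ext; simp
  -- The bracket is `D²μ (0, x) (y, 0) - D²μ (y, 0) (0, x)`.
  have hs : IsSymmSndFDerivAt ℝ μ (p, p) := hμ.isSymmSndFDerivAt (by simp)
  rw [lieBracket, hV'.fderiv, hW'.fderiv, hVp, hWp]
  simpa [sub_eq_zero] using hs (0, x) (y, 0)

end ModelSpace

section LieGroup

open Filter Topology

variable {E : Type*} [NormedAddCommGroup E] [NormedSpace ℝ E]
  {G : Type*} [TopologicalSpace G] [ChartedSpace E G]

theorem mfderivWithin_extChartAt_symm_inverse [IsManifold 𝓘(ℝ, E) ∞ G] (g : G) {a : E}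
    (ha : a ∈ (extChartAt 𝓘(ℝ, E) g).target) :
    (mfderivWithin 𝓘(ℝ, E) 𝓘(ℝ, E) (extChartAt 𝓘(ℝ, E) g).symm (Set.range 𝓘(ℝ, E)) a).inverse =
      mfderiv 𝓘(ℝ, E) 𝓘(ℝ, E) (extChartAt 𝓘(ℝ, E) g) ((extChartAt 𝓘(ℝ, E) g).symm a) :=
  ContinuousLinearMap.inverse_eq
    (mfderivWithin_extChartAt_symm_comp_mfderiv_extChartAt ha)
    (mfderiv_extChartAt_comp_mfderivWithin_extChartAt_symm ha)

variable [Group G] [LieGroup 𝓘(ℝ, E) ∞ G]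

theorem contDiffAt_mul_extChartAt_one :
    ContDiffAt ℝ ∞ (fun q : E × E => extChartAt 𝓘(ℝ, E) (1 : G)
      ((extChartAt 𝓘(ℝ, E) (1 : G)).symm q.1 * (extChartAt 𝓘(ℝ, E) (1 : G)).symm q.2))
      (extChartAt 𝓘(ℝ, E) (1 : G) 1, extChartAt 𝓘(ℝ, E) (1 : G) 1) := by
  rw [← contMDiffAt_iff_contDiffAt]
  set φ := extChartAt 𝓘(ℝ, E) (1 : G) with hφ
  have h1 : φ.symm (φ 1) = 1 := extChartAt_to_inv (1 : G)
  have hs : ContMDiffAt 𝓘(ℝ, E) 𝓘(ℝ, E) ∞ φ.symm (φ 1) :=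
    (contMDiffOn_extChartAt_symm (1 : G)).contMDiffAt (extChartAt_target_mem_nhds (1 : G))
  have hm : ContMDiffAt 𝓘(ℝ, E × E) 𝓘(ℝ, E) ∞
      (fun q : E × E => φ.symm q.1 * φ.symm q.2) (φ 1, φ 1) := by
    refine ContMDiffAt.mul (ContMDiffAt.comp (φ 1, φ 1) (g := φ.symm) (f := Prod.fst) hs ?_)
      (ContMDiffAt.comp (φ 1, φ 1) (g := φ.symm) (f := Prod.snd) hs ?_)
    · exact contDiffAt_fst.contMDiffAt
    · exact contDiffAt_snd.contMDiffAt
  have hφ1 : ContMDiffAt 𝓘(ℝ, E) 𝓘(ℝ, E) ∞ φ (φ.symm (φ 1) * φ.symm (φ 1)) := by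
    rw [h1, mul_one]
    exact contMDiffAt_extChartAt
  exact ContMDiffAt.comp (φ 1, φ 1) hφ1 hm

/-- Left-invariant and right-invariant vector fields commute (at the identity). -/
theorem mlieBracket_mulInvariant_rightInvariant (x y : GroupLieAlgebra 𝓘(ℝ, E) G) :
    mlieBracket 𝓘(ℝ, E) (mulInvariantVectorField x) (rightInvariantVectorField y) (1 : G) = 0 := by
  set φ := extChartAt 𝓘(ℝ, E) (1 : G) with hφ
  have h1 : φ.symm (φ 1) = 1 := extChartAt_to_inv (1 : G)
  set μ : E × E → E := fun q => φ (φ.symm q.1 * φ.symm q.2) with hμdef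
  have hμ : ContDiffAt ℝ ∞ μ (φ 1, φ 1) := contDiffAt_mul_extChartAt_one
  have htarget : φ.target ∈ 𝓝 (φ 1) := extChartAt_target_mem_nhds (1 : G)
  have hsource : φ.source ∈ 𝓝 (1 : G) := extChartAt_source_mem_nhds (1 : G)
  have hdiff : ∀ᶠ q in 𝓝 (φ 1, φ 1), DifferentiableAt ℝ μ q :=
    ((hμ.of_le (m := 1) (by simp)).eventually (by simp)).mono fun q hq => hq.differentiableAt (by simp)
  have hφd : ∀ g ∈ φ.source, MDifferentiableAt 𝓘(ℝ, E) 𝓘(ℝ, E) φ g := fun g hg =>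
    mdifferentiableAt_extChartAt (by simpa [hφ] using hg)
  have hV : ∀ᶠ a in 𝓝 (φ 1), mpullbackWithin 𝓘(ℝ, E) 𝓘(ℝ, E) φ.symm (mulInvariantVectorField x)
      (Set.range 𝓘(ℝ, E)) a = fderiv ℝ μ (a, φ 1)
        (0, mfderiv 𝓘(ℝ, E) 𝓘(ℝ, E) φ 1 x) := by
    have hl : ContinuousAt (fun a : E => (a, φ 1)) (φ 1) := by fun_prop
    filter_upwards [htarget, hl.eventually hdiff] with a ha hda
    rw [mpullbackWithin_apply, mfderivWithin_extChartAt_symm_inverse _ ha]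
    have hsource_a : φ.symm a * 1 ∈ φ.source := by rw [mul_one]; exact φ.map_target ha
    -- The map `g ↦ φ (φ.symm a * g)` is differentiated at `1` directly and through `μ`; comparing
    -- the two expresses the field in the chart as a partial derivative of `μ`.
    have e1 : HasMFDerivAt 𝓘(ℝ, E) 𝓘(ℝ, E) (φ ∘ (φ.symm a * ·)) 1
        ((mfderiv 𝓘(ℝ, E) 𝓘(ℝ, E) φ (φ.symm a * 1)).comp
          (mfderiv 𝓘(ℝ, E) 𝓘(ℝ, E) (φ.symm a * ·) 1)) :=
      HasMFDerivAt.comp 1 (hφd _ hsource_a).hasMFDerivAt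
        ((contMDiff_mul_left (I := 𝓘(ℝ, E)) (n := ∞)).mdifferentiable (by simp) 1).hasMFDerivAt
    have e2 : HasFDerivAt (fun b => μ (a, b)) ((fderiv ℝ μ (a, φ 1)).comp
        (ContinuousLinearMap.inr ℝ E E)) (φ 1) :=
      HasFDerivAt.comp (g := μ) (f := fun b => (a, b)) _ hda.hasFDerivAt
        (hasFDerivAt_prodMk_right a (φ 1))
    have e3 : HasMFDerivAt 𝓘(ℝ, E) 𝓘(ℝ, E) ((fun b => μ (a, b)) ∘ φ) 1
        (((fderiv ℝ μ (a, φ 1)).comp (ContinuousLinearMap.inr ℝ E E)).comp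
          (mfderiv 𝓘(ℝ, E) 𝓘(ℝ, E) φ 1)) :=
      HasMFDerivAt.comp 1 e2.hasMFDerivAt (hφd _ (mem_of_mem_nhds hsource)).hasMFDerivAt
    have e4 : φ ∘ (φ.symm a * ·) =ᶠ[𝓝 1] (fun b => μ (a, b)) ∘ φ := by
      filter_upwards [hsource] with g hg
      simp [hμdef, φ.left_inv hg]
    have e5 := hasMFDerivAt_unique e1 (e3.congr_of_eventuallyEq e4)
    have e6 := congrArg (fun A : E →L[ℝ] E => A x) e5
    rw [mul_one] at e6
    exact e6
  have hW : ∀ᶠ b in 𝓝 (φ 1), mpullbackWithin 𝓘(ℝ, E) 𝓘(ℝ, E) φ.symm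
      (rightInvariantVectorField y) (Set.range 𝓘(ℝ, E)) b = fderiv ℝ μ (φ 1, b)
        (mfderiv 𝓘(ℝ, E) 𝓘(ℝ, E) φ 1 y, 0) := by
    have hr : ContinuousAt (fun b : E => (φ 1, b)) (φ 1) := by fun_prop
    filter_upwards [htarget, hr.eventually hdiff] with b hb hdb
    rw [mpullbackWithin_apply, mfderivWithin_extChartAt_symm_inverse _ hb]
    have hsource_b : 1 * φ.symm b ∈ φ.source := by rw [one_mul]; exact φ.map_target hb
    have e1 : HasMFDerivAt 𝓘(ℝ, E) 𝓘(ℝ, E) (φ ∘ (· * φ.symm b)) 1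
        ((mfderiv 𝓘(ℝ, E) 𝓘(ℝ, E) φ (1 * φ.symm b)).comp
          (mfderiv 𝓘(ℝ, E) 𝓘(ℝ, E) (· * φ.symm b) 1)) :=
      HasMFDerivAt.comp 1 (hφd _ hsource_b).hasMFDerivAt
        ((contMDiff_mul_right (I := 𝓘(ℝ, E)) (n := ∞)).mdifferentiable (by simp) 1).hasMFDerivAt
    have e2 : HasFDerivAt (fun a => μ (a, b)) ((fderiv ℝ μ (φ 1, b)).comp
        (ContinuousLinearMap.inl ℝ E E)) (φ 1) :=
      HasFDerivAt.comp (g := μ) (f := fun a => (a, b)) _ hdb.hasFDerivAt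
        (hasFDerivAt_prodMk_left (φ 1) b)
    have e3 : HasMFDerivAt 𝓘(ℝ, E) 𝓘(ℝ, E) ((fun a => μ (a, b)) ∘ φ) 1
        (((fderiv ℝ μ (φ 1, b)).comp (ContinuousLinearMap.inl ℝ E E)).comp
          (mfderiv 𝓘(ℝ, E) 𝓘(ℝ, E) φ 1)) :=
      HasMFDerivAt.comp 1 e2.hasMFDerivAt (hφd _ (mem_of_mem_nhds hsource)).hasMFDerivAt
    have e4 : φ ∘ (· * φ.symm b) =ᶠ[𝓝 1] (fun a => μ (a, b)) ∘ φ := by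
      filter_upwards [hsource] with g hg
      simp [hμdef, φ.left_inv hg]
    have e5 := hasMFDerivAt_unique e1 (e3.congr_of_eventuallyEq e4)
    have e6 := congrArg (fun A : E →L[ℝ] E => A y) e5
    rw [one_mul] at e6
    exact e6
  have hleft : ∀ᶠ b in 𝓝 (φ 1), μ (φ 1, b) = b := by
    filter_upwards [htarget] with b hb
    simp only [hμdef, h1, one_mul]
    exact φ.right_inv hb
  have hright : ∀ᶠ a in 𝓝 (φ 1), μ (a, φ 1) = a := by
    filter_upwards [htarget] with a ha
    simp only [hμdef, h1, mul_one]
    exact φ.right_inv ha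
  have h := lieBracket_eq_zero_of_local_mul (hμ.of_le (by exact ENat.LEInfty.out)) hleft hright _ _
    hV hW
  rw [← mlieBracketWithin_univ, mlieBracketWithin_apply]
  have hset : (extChartAt 𝓘(ℝ, E) (1 : G)).symm ⁻¹' Set.univ ∩ Set.range 𝓘(ℝ, E) = Set.univ := by
    simp
  rw [hset]
  have h' := (congrFun (lieBracketWithin_univ (𝕜 := ℝ) (E := E)) (φ 1)).trans h
  refine (congrArg _ h').trans ?_
  exact ContinuousLinearMap.map_zero _

end LieGroup

/-! ### Exponentials, symmetric algebras and isometries -/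

section Exponential

variable {V : Type*} [NormedAddCommGroup V] [NormedSpace ℝ V] [FiniteDimensional ℝ V]

theorem expEnd_apply_of_apply_eq_zero {A : V →ₗ[ℝ] V} {v : V} (h : A v = 0) :
    expEnd V A v = v := by
  have hs := NormedSpace.exp_series_hasSum_exp' (𝕂 := ℝ) (LinearMap.toContinuousLinearMap A)
  have hs' := (ContinuousLinearMap.apply ℝ V v).hasSum hs
  refine hs'.unique ?_
  convert! hasSum_single (f := fun n : ℕ => ContinuousLinearMap.apply ℝ V v
    ((n.factorial : ℝ)⁻¹ • LinearMap.toContinuousLinearMap A ^ n)) 0 fun n hn => ?_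
  · simp
  · obtain ⟨m, rfl⟩ := Nat.exists_eq_succ_of_ne_zero hn
    simp [pow_succ, h]

end Exponential

section SymmetricAlgebra

variable {V W : Type*} [NormedAddCommGroup V] [InnerProductSpace ℝ V] [FiniteDimensional ℝ V]
  [NormedAddCommGroup W] [InnerProductSpace ℝ W] [FiniteDimensional ℝ W]

/-- The map on symmetric algebras induced by a linear map. -/
noncomputable def symMap (φ : V →ₗ[ℝ] W) : SymmetricAlgebra ℝ V →ₐ[ℝ] SymmetricAlgebra ℝ W :=
  SymmetricAlgebra.lift ((SymmetricAlgebra.ι ℝ W).comp φ)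

/-- Pairing with `w` turns the contravariant metric into a quadratic form, which is how isometry is
read off from an identity in the symmetric algebra. -/
theorem lift_metricElement (w : V) :
    SymmetricAlgebra.lift (innerₗ V w) (metricElement V) = (1 / 2 : ℝ) * inner ℝ w w := by
  rw [metricElement, map_smul, map_sum, ← (stdOrthonormalBasis ℝ V).sum_inner_mul_inner w w]
  simp only [map_mul, SymmetricAlgebra.lift_ι_apply, innerₗ_apply_apply, smul_eq_mul]
  congr 1
  exact Finset.sum_congr rfl fun i _ => by rw [real_inner_comm w]

/-- Evaluating the pushforward at `w` amounts to evaluating the original element at the adjoint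
image of `w`. So the adjoint is isometric, hence a right inverse of `φ`, and by injectivity also a
left inverse. -/
theorem inner_map_map_of_symMap_metricElement {φ : V →ₗ[ℝ] W} (hφ : Function.Injective φ)
    (h : symMap φ (metricElement V) = metricElement W) (x : V) :
    inner ℝ (φ x) (φ x) = (inner ℝ x x : ℝ) := by
  have hadj : ∀ w : W, inner ℝ (φ.adjoint w) (φ.adjoint w) = (inner ℝ w w : ℝ) := fun w => by
    have h1 := congrArg (SymmetricAlgebra.lift (innerₗ W w)) h
    have h2 : (SymmetricAlgebra.lift (innerₗ W w)).comp (symMap φ) =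
        SymmetricAlgebra.lift (innerₗ V (φ.adjoint w)) := by
      apply SymmetricAlgebra.algHom_ext
      ext v
      simp [symMap, LinearMap.adjoint_inner_left]
    have h3 := congrArg (fun A => A (metricElement V)) h2
    simp only [AlgHom.comp_apply] at h3
    rw [h3, lift_metricElement, lift_metricElement] at h1
    linarith
  let ψ : W →ₗᵢ[ℝ] V := ⟨φ.adjoint, fun w => by
    rw [← sq_eq_sq₀ (norm_nonneg _) (norm_nonneg _), ← real_inner_self_eq_norm_sq,
      ← real_inner_self_eq_norm_sq, hadj]⟩
  have hright : ∀ w, φ (φ.adjoint w) = w := fun w => ext_inner_right ℝ fun w' => by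
    rw [← LinearMap.adjoint_inner_right]
    exact ψ.inner_map_map w w'
  rw [← LinearMap.adjoint_inner_left, hφ (hright (φ x))]

end SymmetricAlgebra

/-! ### Automorphisms fixing a Lie algebra vector, and induced fields -/

section Automorphisms

variable {E : Type*} [NormedAddCommGroup E] [NormedSpace ℝ E]
    {G : Type*} [TopologicalSpace G] [ChartedSpace E G] [Group G] [LieGroup 𝓘(ℝ, E) ∞ G]

/-- Differentiate `f ∘ (u * ·) = (f u * ·) ∘ f` at `1`. -/
theorem mfderiv_mulEquiv_mulInvariantVectorField {f : G ≃* G}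
    (hf : ContMDiff 𝓘(ℝ, E) 𝓘(ℝ, E) ∞ f) {v : GroupLieAlgebra 𝓘(ℝ, E) G}
    (hv : tangentMap 𝓘(ℝ, E) 𝓘(ℝ, E) f ⟨1, v⟩ = (⟨1, v⟩ : TangentBundle 𝓘(ℝ, E) G)) (u : G) :
    mfderiv 𝓘(ℝ, E) 𝓘(ℝ, E) f u (mulInvariantVectorField v u) =
      mulInvariantVectorField v (f u) := by
  have hd : MDifferentiable 𝓘(ℝ, E) 𝓘(ℝ, E) f := hf.mdifferentiable (by simp)
  have hm : ∀ a : G, MDifferentiable 𝓘(ℝ, E) 𝓘(ℝ, E) (a * ·) := fun a =>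
    (contMDiff_mul_left (I := 𝓘(ℝ, E)) (n := ∞)).mdifferentiable (by simp)
  have h1 := mfderiv_comp (1 : G) (hd (u * 1)) (hm u 1)
  have h2 := mfderiv_comp (1 : G) (hm (f u) (f 1)) (hd 1)
  have h3 : f ∘ (u * ·) = (f u * ·) ∘ f := by ext g; simp
  rw [h3, h2] at h1
  have h4 : (mfderiv 𝓘(ℝ, E) 𝓘(ℝ, E) f 1 v : E) = v :=
    congrArg (fun p : TangentBundle 𝓘(ℝ, E) G => (p.2 : E)) hv
  have h5 := congrArg (fun A : E →L[ℝ] E => A v) h1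
  have h6 : (mfderiv 𝓘(ℝ, E) 𝓘(ℝ, E) (f u * ·) (f 1) (mfderiv 𝓘(ℝ, E) 𝓘(ℝ, E) f 1 v) : E) =
      mfderiv 𝓘(ℝ, E) 𝓘(ℝ, E) f (u * 1) (mfderiv 𝓘(ℝ, E) 𝓘(ℝ, E) (u * ·) 1 v) := h5
  have h7 : (mfderiv 𝓘(ℝ, E) 𝓘(ℝ, E) (f u * ·) (f 1) v : E) =
      mfderiv 𝓘(ℝ, E) 𝓘(ℝ, E) f (u * 1) (mfderiv 𝓘(ℝ, E) 𝓘(ℝ, E) (u * ·) 1 v) :=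
    (congrArg (fun w : E => (mfderiv 𝓘(ℝ, E) 𝓘(ℝ, E) (f u * ·) (f 1) : E →L[ℝ] E) w)
      h4).symm.trans h6
  rw [mul_one, map_one] at h7
  exact h7.symm

open Set in
-- `f ∘ γ` is an integral curve of the same field with the same initial point, so uniqueness
-- applies.
theorem mulEquiv_apply_integralCurve [T2Space G] {f : G ≃* G}
    (hf : ContMDiff 𝓘(ℝ, E) 𝓘(ℝ, E) ∞ f) {v : GroupLieAlgebra 𝓘(ℝ, E) G}
    (hv : tangentMap 𝓘(ℝ, E) 𝓘(ℝ, E) f ⟨1, v⟩ = (⟨1, v⟩ : TangentBundle 𝓘(ℝ, E) G))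
    {γ : ℝ → G} {a b : ℝ} (h0 : 0 ∈ Ioo a b) (hγ0 : γ 0 = 1)
    (hγ : IsMIntegralCurveOn (I := 𝓘(ℝ, E)) γ (mulInvariantVectorField v) (Ioo a b)) :
    EqOn (f ∘ γ) γ (Ioo a b) := by
  have hfγ : IsMIntegralCurveOn (I := 𝓘(ℝ, E)) (f ∘ γ) (mulInvariantVectorField v) (Ioo a b) := by
    intro t ht
    have h := HasMFDerivAt.comp_hasMFDerivWithinAt t
      (hf.mdifferentiable (by simp) (γ t)).hasMFDerivAt (hγ t ht)
    have key : ∀ (A : E →L[ℝ] E) (w w' : E), A w = w' →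
        A.comp ((1 : ℝ →L[ℝ] ℝ).smulRight w) = (1 : ℝ →L[ℝ] ℝ).smulRight w' := by
      rintro A w w' rfl
      ext
      simp
    exact HasMFDerivWithinAt.congr_mfderiv h
      (key _ _ _ (mfderiv_mulEquiv_mulInvariantVectorField hf hv (γ t)))
  exact isMIntegralCurveOn_Ioo_eqOn_of_contMDiff_boundaryless h0
    ((contMDiff_mulInvariantVectorField_infty v).of_le (by simp)) hfγ hγ (by simp [hγ0])

end Automorphisms

section InducedFields

variable {E : Type*} [NormedAddCommGroup E] [NormedSpace ℝ E] [FiniteDimensional ℝ E]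
    {G : Type*} [TopologicalSpace G] [ChartedSpace E G] [Group G] [LieGroup 𝓘(ℝ, E) ∞ G]
    [RiemannianBundle (fun x : G => TangentSpace 𝓘(ℝ, E) x)]

open Set in
/-- The field induced by a derivation `T` vanishes along the one-parameter subgroup of every vector
in the kernel of `T`. -/
theorem IsInducedBy.eq_zero_of_integralCurve [T2Space G]
    {T : LieDerivation ℝ (GroupLieAlgebra 𝓘(ℝ, E) G) (GroupLieAlgebra 𝓘(ℝ, E) G)}
    {X : Π u : G, TangentSpace 𝓘(ℝ, E) u} (hX : IsInducedBy T X)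
    {v : GroupLieAlgebra 𝓘(ℝ, E) G} (hT : T v = 0)
    {γ : ℝ → G} {a b : ℝ} (h0 : 0 ∈ Ioo a b) (hγ0 : γ 0 = 1)
    (hγ : IsMIntegralCurveOn (I := 𝓘(ℝ, E)) γ (mulInvariantVectorField v) (Ioo a b))
    {s : ℝ} (hs : s ∈ Ioo a b) : X (γ s) = 0 := by
  obtain ⟨f, hf, hfT, hfX⟩ := hX
  have hfix : ∀ t, f t (γ s) = γ s := fun t => by
    refine mulEquiv_apply_integralCurve (hf t) ?_ h0 hγ0 hγ hs
    rw [hfT]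
    have h1 : (t • T.toLinearMap : TangentSpace 𝓘(ℝ, E) (1 : G) →ₗ[ℝ] _) v = 0 := by
      change t • T v = 0
      rw [hT, smul_zero]
    exact congrArg _ (expEnd_apply_of_apply_eq_zero h1)
  have h1 := hfX (γ s)
  have h2 : (fun t => f t (γ s)) = fun _ => γ s := funext hfix
  have h3 : HasMFDerivAt 𝓘(ℝ, ℝ) 𝓘(ℝ, E) (fun t => f t (γ s)) 0 (0 : ℝ →L[ℝ] E) := by
    rw [h2]; exact hasMFDerivAt_const _ _
  have h4 := congrArg (fun A : ℝ →L[ℝ] E => A 1) (hasMFDerivAt_unique h1 h3)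
  have h5 : (X (f 0 (γ s)) : E) = 0 := (one_smul ℝ (X (f 0 (γ s)) : E)).symm.trans h4
  rw [hfix] at h5
  exact h5

end InducedFields

/-! ### Right-invariance of the metric along a curve -/

section RightTranslation

variable {E : Type*} [NormedAddCommGroup E] [NormedSpace ℝ E]
    {G : Type*} [TopologicalSpace G] [ChartedSpace E G] [Group G]
    [RiemannianBundle (fun x : G => TangentSpace 𝓘(ℝ, E) x)]

/-- If all generating fields are right-invariant along `S`, so are all elements of the algebra. -/
theorem exists_symMap_of_mem_adjoin {𝒜 : Set (Π u : G, TangentSpace 𝓘(ℝ, E) u)} {S : Set G}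
    (h𝒜 : ∀ X ∈ 𝒜, ∃ v, ∀ u ∈ S, X u = rightTranslation 𝓘(ℝ, E) u v)
    {P : SymTensorField 𝓘(ℝ, E) G} (hP : P ∈ Algebra.adjoin ℝ (ofVectorField '' 𝒜)) :
    ∃ Q : SymmetricAlgebra ℝ (TangentSpace 𝓘(ℝ, E) (1 : G)), ∀ u ∈ S,
      P u = symMap (V := TangentSpace 𝓘(ℝ, E) (1 : G)) (rightTranslation 𝓘(ℝ, E) u) Q := by
  induction hP using Algebra.adjoin_induction with
  | mem P hP =>
    obtain ⟨X, hX, rfl⟩ := hP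
    obtain ⟨v, hv⟩ := h𝒜 X hX
    refine ⟨SymmetricAlgebra.ι ℝ _ v, fun u hu => ?_⟩
    rw [symMap, SymmetricAlgebra.lift_ι_apply, ofVectorField, hv u hu]
    rfl
  | algebraMap r =>
    refine ⟨algebraMap ℝ _ r, fun u _ => ?_⟩
    rw [AlgHom.commutes]
    rfl
  | add P P' _ _ h h' =>
    obtain ⟨Q, hQ⟩ := h
    obtain ⟨Q', hQ'⟩ := h'
    refine ⟨Q + Q', fun u hu => ?_⟩
    rw [map_add, ← hQ u hu, ← hQ' u hu]
    rfl
  | mul P P' _ _ h h' =>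
    obtain ⟨Q, hQ⟩ := h
    obtain ⟨Q', hQ'⟩ := h'
    refine ⟨Q * Q', fun u hu => ?_⟩
    rw [map_mul, ← hQ u hu, ← hQ' u hu]
    rfl

variable [FiniteDimensional ℝ E] [LieGroup 𝓘(ℝ, E) ∞ G]

/-- Evaluation at `1` identifies the fixed tensor with the metric at `1`, so right translation by
points of `S` preserves the metric element and is isometric. -/
theorem inner_rightInvariantVectorField_of_mem_adjoin
    {𝒜 : Set (Π u : G, TangentSpace 𝓘(ℝ, E) u)} {S : Set G} (h1 : 1 ∈ S)
    (h𝒜 : ∀ X ∈ 𝒜, ∃ v, ∀ u ∈ S, X u = rightTranslation 𝓘(ℝ, E) u v)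
    (hmem : metricField 𝓘(ℝ, E) G ∈ Algebra.adjoin ℝ (ofVectorField '' 𝒜)) {u : G} (hu : u ∈ S)
    (x : TangentSpace 𝓘(ℝ, E) (1 : G)) :
    inner ℝ (rightInvariantVectorField x u) (rightInvariantVectorField x u) =
      (inner ℝ x x : ℝ) := by
  obtain ⟨Q, hQ⟩ := exists_symMap_of_mem_adjoin h𝒜 hmem
  have hid : rightTranslation 𝓘(ℝ, E) (1 : G) = LinearMap.id :=
    LinearMap.ext fun v => rightInvariantVectorField_one v
  have hsym : symMap (V := TangentSpace 𝓘(ℝ, E) (1 : G)) (rightTranslation 𝓘(ℝ, E) (1 : G)) =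
      AlgHom.id ℝ _ := by
    rw [hid, symMap]
    exact SymmetricAlgebra.lift_ι
  have hQ1 := hQ 1 h1
  rw [hsym] at hQ1
  have hQu := hQ u hu
  rw [← show metricField 𝓘(ℝ, E) G 1 = Q from hQ1] at hQu
  exact inner_map_map_of_symMap_metricElement (rightTranslation_injective (I := 𝓘(ℝ, E)) u) hQu.symm x

variable [IsContMDiffRiemannianBundle 𝓘(ℝ, E) ∞ E (fun x : G => TangentSpace 𝓘(ℝ, E) x)]
  {cov : CovariantDerivative 𝓘(ℝ, E) E (fun x : G => TangentSpace 𝓘(ℝ, E) x)}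

/-- A right-invariant field of constant length along an integral curve of a left-invariant field
`e` satisfies `⟨∇ₓ e, x⟩ = 0` at the identity. -/
theorem inner_leviCivitaProduct_eq_zero (hcov : IsLeviCivita cov)
    {x e : TangentSpace 𝓘(ℝ, E) (1 : G)} {γ : ℝ → G} (hγ0 : γ 0 = 1)
    (hγ : HasMFDerivAt 𝓘(ℝ, ℝ) 𝓘(ℝ, E) γ 0
      ((1 : ℝ →L[ℝ] ℝ).smulRight (mulInvariantVectorField e (γ 0))))
    (hconst : ∀ᶠ t in nhds (0 : ℝ), inner ℝ (rightInvariantVectorField x (γ t))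
      (rightInvariantVectorField x (γ t)) = (inner ℝ x x : ℝ)) :
    inner ℝ (leviCivitaProduct cov x e) x = (0 : ℝ) := by
  have hX : MDifferentiableAt 𝓘(ℝ, E) 𝓘(ℝ, E).tangent
      (fun g : G => (⟨g, rightInvariantVectorField x g⟩ : TangentBundle 𝓘(ℝ, E) G)) 1 :=
    (contMDiff_rightInvariantVectorField x).mdifferentiable (by simp) 1
  have hL := mdifferentiableAt_mulInvariantVectorField_infty e (1 : G)
  have hmetric := hcov.1.mvfderiv_inner_eq (mulInvariantVectorField e) hX hX
  -- Since the two fields commute at `1`, zero torsion exchanges `∇ₑ X` for `∇_X e`, which depends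
  -- on `X` only through its value `x` there.
  have htor := (cov.torsion_eq_zero_iff).1 hcov.2 hL hX
  rw [mlieBracket_mulInvariant_rightInvariant, sub_eq_zero] at htor
  set F : G → ℝ := fun g => inner ℝ (rightInvariantVectorField x g)
    (rightInvariantVectorField x g) with hF
  have hFd : MDifferentiableAt 𝓘(ℝ, E) 𝓘(ℝ, ℝ) F (γ 0) := by
    rw [hγ0]; exact MDifferentiableAt.inner_bundle (E := fun x : G => TangentSpace 𝓘(ℝ, E) x) hX hX
  have h1 : HasMFDerivAt 𝓘(ℝ, ℝ) 𝓘(ℝ, ℝ) (F ∘ γ) 0 _ := hFd.hasMFDerivAt.comp 0 hγ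
  have h2 : HasMFDerivAt 𝓘(ℝ, ℝ) 𝓘(ℝ, ℝ) (F ∘ γ) 0 (0 : ℝ →L[ℝ] ℝ) :=
    (hasMFDerivAt_const (inner ℝ x x : ℝ) (0 : ℝ)).congr_of_eventuallyEq hconst
  have h3 := congrArg (fun A : ℝ →L[ℝ] ℝ => A 1) (hasMFDerivAt_unique h1 h2)
  have h4 : (mfderiv 𝓘(ℝ, E) 𝓘(ℝ, ℝ) F (γ 0) ((1 : ℝ) • mulInvariantVectorField e (γ 0)) : ℝ) = 0 :=
    h3
  rw [one_smul, hγ0] at h4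
  have h5 := hmetric.symm.trans h4
  beta_reduce at h5
  rw [htor] at h5
  rw [rightInvariantVectorField_one] at h5
  have h6 : inner ℝ (leviCivitaProduct cov x e) x + inner ℝ x (leviCivitaProduct cov x e) =
    (0 : ℝ) := h5
  rw [real_inner_comm] at h6
  linarith [real_inner_comm x (leviCivitaProduct cov x e)]

end RightTranslation

/-! ### Almost abelian groups and the main theorem -/

section AlmostAbelianGroups

variable {E : Type*} [NormedAddCommGroup E] [NormedSpace ℝ E] [FiniteDimensional ℝ E]
    {G : Type*} [TopologicalSpace G] [ChartedSpace E G] [Group G] [LieGroup 𝓘(ℝ, E) ∞ G]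
    [RiemannianBundle (fun x : G => TangentSpace 𝓘(ℝ, E) x)]

theorem exists_abelianIdealNormal (hG : IsAlmostAbelian (GroupLieAlgebra 𝓘(ℝ, E) G)) :
    ∃ e : TangentSpace 𝓘(ℝ, E) (1 : G), IsAbelianIdealNormal (lieBracketProduct E G) e := by
  obtain ⟨h, hab, hfin⟩ := hG
  let W : Submodule ℝ (TangentSpace 𝓘(ℝ, E) (1 : G)) := h.toSubmodule
  have hW : Module.finrank ℝ Wᗮ = 1 := by
    have h1 := Submodule.finrank_add_finrank_orthogonal W
    have h2 := Submodule.finrank_quotient_add_finrank W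
    have h3 : Module.finrank ℝ (TangentSpace 𝓘(ℝ, E) (1 : G) ⧸ W) = 1 := hfin
    omega
  obtain ⟨v, hv0, hv⟩ := finrank_eq_one_iff'.1 hW
  have hv0' : (v : TangentSpace 𝓘(ℝ, E) (1 : G)) ≠ 0 := by simpa using hv0
  have hspan : Wᗮ = ℝ ∙ (v : TangentSpace 𝓘(ℝ, E) (1 : G)) := by
    refine le_antisymm (fun w hw => ?_) ((Submodule.span_singleton_le_iff_mem _ _).2 v.2)
    obtain ⟨c, hc⟩ := hv ⟨w, hw⟩
    exact Submodule.mem_span_singleton.2 ⟨c, congrArg Subtype.val hc⟩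
  -- The double orthogonal complement recovers the ideal as the hyperplane orthogonal to `v`.
  have hmem : ∀ x, x ∈ W ↔ inner ℝ (v : TangentSpace 𝓘(ℝ, E) (1 : G)) x = (0 : ℝ) := fun x => by
    rw [← Submodule.mem_orthogonal_singleton_iff_inner_right, ← hspan,
      Submodule.orthogonal_orthogonal]
  set r : ℝ := ‖(v : TangentSpace 𝓘(ℝ, E) (1 : G))‖⁻¹ with hr
  have hr0 : r ≠ 0 := inv_ne_zero (norm_ne_zero_iff.2 hv0')
  have hmem' : ∀ x, inner ℝ (r • (v : TangentSpace 𝓘(ℝ, E) (1 : G))) x = (0 : ℝ) ↔ x ∈ W :=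
    fun x => by
      rw [hmem, inner_smul_left]
      simp [hr0]
  refine ⟨r • (v : TangentSpace 𝓘(ℝ, E) (1 : G)), ?_, fun z x hx => ?_, fun x y hx hy => ?_⟩
  · rw [real_inner_self_eq_norm_sq, norm_smul, hr, norm_inv, norm_norm,
      inv_mul_cancel₀ (norm_ne_zero_iff.2 hv0'), one_pow]
  · rw [hmem'] at hx ⊢
    exact h.lie_mem hx
  · rw [hmem'] at hx hy
    exact congrArg Subtype.val (hab.trivial ⟨x, hx⟩ ⟨y, hy⟩)

end AlmostAbelianGroups

end AlmostAbelian

open AlmostAbelian in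
theorem theorem6p5 {E : Type*} [NormedAddCommGroup E] [NormedSpace ℝ E] [FiniteDimensional ℝ E]
    {G : Type*} [TopologicalSpace G] [ChartedSpace E G] [Group G] [LieGroup 𝓘(ℝ, E) ∞ G]
    [ConnectedSpace G]
    (hG : AlmostAbelian.IsAlmostAbelian (GroupLieAlgebra 𝓘(ℝ, E) G))
    (hdim : 2 ≤ Module.finrank ℝ E)
    [RiemannianBundle (fun x : G => TangentSpace 𝓘(ℝ, E) x)]
    [IsContMDiffRiemannianBundle 𝓘(ℝ, E) ∞ E (fun x : G => TangentSpace 𝓘(ℝ, E) x)]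
    (hg : AlmostAbelian.IsLeftInvariantMetric 𝓘(ℝ, E) G)
    (cov : CovariantDerivative 𝓘(ℝ, E) E (fun x : G => TangentSpace 𝓘(ℝ, E) x))
    (hcov : AlmostAbelian.IsLeviCivita cov)
    (κ : ℝ) (hκ : κ ≠ 0) (hcurv : AlmostAbelian.HasConstantSectionalCurvature cov κ) :
    AlmostAbelian.metricField 𝓘(ℝ, E) G ∉
      Algebra.adjoin ℝ (AlmostAbelian.ofVectorField '' AlmostAbelian.algebraicFields 𝓘(ℝ, E) G) := by
  intro hmem
  obtain ⟨e, he⟩ := exists_abelianIdealNormal hG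
  have hB := isLeviCivitaProduct hg hcov
  have halt : ∀ x, lieBracketProduct E G x x = 0 := fun x =>
    lie_self (L := GroupLieAlgebra 𝓘(ℝ, E) G) x
  have hcurv' := inner_leviCivitaProduct_curvature hg hcov hcurv he.norm_eq
  have hdim' : 2 ≤ Module.finrank ℝ (TangentSpace 𝓘(ℝ, E) (1 : G)) := hdim
  obtain ⟨x, hx⟩ := hB.exists_inner_ne_zero he halt hdim' hcurv' hκ
  -- Uniqueness of integral curves needs `G` Hausdorff; a topological group that is T1 is Hausdorff.
  have : IsTopologicalGroup G := topologicalGroup_of_lieGroup 𝓘(ℝ, E) ∞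
  have : T1Space G := ChartedSpace.t1Space E G
  have : T2Space G := inferInstance
  obtain ⟨γ, hγ0, hγ⟩ := exists_isMIntegralCurveAt_of_contMDiffAt_boundaryless
    (I := 𝓘(ℝ, E)) (v := mulInvariantVectorField e) 0
    (((contMDiff_mulInvariantVectorField_infty e).of_le (by simp)).contMDiffAt (x := (1 : G)))
  obtain ⟨ε, hε, hball⟩ := isMIntegralCurveAt_iff'.1 hγ
  rw [Real.ball_eq_Ioo, zero_sub, zero_add] at hball
  have h0 : (0 : ℝ) ∈ Set.Ioo (-ε) ε := by simp [hε]
  refine hx (inner_leviCivitaProduct_eq_zero hcov hγ0 hγ.hasMFDerivAt ?_)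
  filter_upwards [Ioo_mem_nhds h0.1 h0.2] with t ht
  refine inner_rightInvariantVectorField_of_mem_adjoin (S := γ '' Set.Ioo (-ε) ε)
    ⟨0, h0, hγ0⟩ ?_ hmem ⟨t, ht, rfl⟩ x
  rintro X (⟨v, rfl⟩ | ⟨T, hT, hTX⟩)
  · exact ⟨v, fun u _ => rfl⟩
  -- An induced field vanishes on the whole arc, so there it is the right-invariant field of the
  -- zero vector.
  · refine ⟨0, ?_⟩
    rintro _ ⟨s, hs, rfl⟩
    rw [map_zero]
    refine hTX.eq_zero_of_integralCurve ?_ h0 hγ0 hball hs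
    exact hB.skew_derivation_normal he halt hdim' hcurv' hκ (T := T.toLinearMap) hT
      fun a b => (T.apply_lie_eq_add a b).trans (add_comm _ _)
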